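/- Let $V$ be a real vector space of dimension $N\ge 2$ (the tangent space at a point of a Lorentzian manifold) with a Lorentzian metric $g_{ab}$ of signature $(+,-,\dots,-)$ and a time orientation. For a $p$-form $\Omega$ ($1\le p\le N$) its superenergy tensor is $$T_{ab}\{\Omega\}=\frac{(-1)^{p-1}}{(p-1)!}\Big[\Omega_{aa_2\dots a_p}\Omega_b{}^{a_2\dots a_p}-\frac1{2p}(\Omega\cdot\Omega)\,g_{ab}\Big],\qquad \Omega\cdot\Omega=\Omega_{a_1\dots a_p}\Omega^{a_1\dots a_p}.$$ $\Omega$ is simple if $\Omega=\omega^1\wedge\dots\wedge\omega^p$ with linearly independent 1-forms $\omega^i$, and null if it is simple and $\Omega\cdot\Omega=0$. Let $\mathcal{SS}$ (resp. $\mathcal{NS}$) be the set of superenergy tensors of simple (resp. null) $p$-forms, $1\le p\le N$, and $-\mathcal{SS}$, $-\mathcal{NS}$ the sets of their negatives. Write $(T\times T)_{ab}=T_{ac}T_b{}^c$. A tensor $T_a{}^b$ is identified with the linear map $k^a\mapsto k^aT_a{}^b$. It is null-cone preserving if it maps every null vector to a null vector (the zero vector being allowed as an image), and bi-preserving if moreover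 $k_b\mapsto T_a{}^bk_b$ does the same for null 1-forms. A null-cone preserving map is orthochronous (resp. time-reversal) if it sends every future-pointing null vector to a vector which is zero or future-pointing (resp. zero or past-pointing); it is singular if its determinant is $0$. A Lorentz transformation is a linear isometry of $g$, and it is involutory if it equals its inverse. (i) Let $T_{ab}$ be symmetric. If $N\ge 3$, then $(T\times T)_{ab}=f g_{ab}$ for some real $f$ if and only if $T=0$ or $T\in\mathcal{SS}\cup-\mathcal{SS}$. If $N=2$, the same equivalence holds with the additional requirement $f\ge 0$. (ii) A tensor $T_{ab}$ is in $\mathcal{SS}\setminus\mathcal{NS}$ (resp. $-\mathcal{SS}\setminus-\mathcal{NS}$) if and only if $T_a{}^b=c\,L_a{}^b$ with $c>0$ and $L$ an involutory orthochronous (resp. time-reversal) Lorentz transformation. (iii) A tensor $T_{ab}$ is in $\mathcal{NS}$ (resp. $-\mathcal{NS}$) if and only if it is non-zero and symmetric and $T_a{}^b$ is a singular orthochronous (resp. time-reversal) null-cone bi-preserving map. -/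

import Mathlib

open LinearMap (BilinForm)
open Module (Dual Basis finrank finBasis)

noncomputable section

/-- A Lorentzian metric `g_ab` on a real vector space (the tangent space at a point), with signature
`(+,-,…,-)`: some basis is orthonormal, its first vector being timelike. -/
structure LorentzMetric (V : Type*) [AddCommGroup V] [Module ℝ V] where
  form : BilinForm ℝ V
  exists_orthonormal : ∃ (n : ℕ) (e : Basis (Fin (n + 1)) ℝ V),
    ∀ i j, form (e i) (e j) = if i = j then (if i = 0 then 1 else -1) else 0

namespace LorentzMetric

variable {V : Type*} [AddCommGroup V] [Module ℝ V]

theorem nondegenerate (g : LorentzMetric V) : g.form.Nondegenerate := by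
  obtain ⟨n, e, he⟩ := g.exists_orthonormal
  have hs : ∀ x y, g.form x y = g.form y x := by
    intro x y
    have h : g.form = LinearMap.flip g.form := by
      refine e.ext fun i => e.ext fun j => ?_
      rw [LinearMap.flip_apply, he, he]
      by_cases h : i = j
      · subst h; rfl
      · rw [if_neg h, if_neg (Ne.symm h)]
    exact congrArg (fun B : BilinForm ℝ V => B x y) h
  have key : ∀ x, (∀ y, g.form x y = 0) → x = 0 := by
    intro x hx
    refine (Basis.ext_elem_iff e).2 fun j => ?_
    have h := hx (e j)
    rw [← e.sum_repr x] at h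
    simp only [map_sum, map_smul, LinearMap.sum_apply, LinearMap.smul_apply, smul_eq_mul, he,
      mul_ite, mul_zero, Finset.sum_ite_eq', Finset.mem_univ, if_true] at h
    rw [map_zero, Finsupp.zero_apply]
    split_ifs at h <;> linarith
  exact ⟨key, fun x hx => key x fun y => by rw [hs]; exact hx y⟩

variable [FiniteDimensional ℝ V]

/-- Raising the index of a 1-form: `g (sharp α) y = α y`. -/
def sharp (g : LorentzMetric V) : Dual ℝ V ≃ₗ[ℝ] V :=
  (BilinForm.toDual g.form g.nondegenerate).symm

/-- The linear map `k^a ↦ k^a T_a{}^b` defined by a rank-2 tensor `T_ab`. -/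
def toMap (g : LorentzMetric V) (T : BilinForm ℝ V) : V →ₗ[ℝ] V :=
  g.sharp.toLinearMap ∘ₗ T

/-- The product `(S × T)_ab = S_ac T_b{}^c`. -/
def cross (g : LorentzMetric V) (S T : BilinForm ℝ V) : BilinForm ℝ V :=
  BilinForm.compRight S (g.toMap T)

/-- The full contraction `A_{c₁…c_p} B^{c₁…c_p}` of two `p`-forms; the indices of `B` are raised by
evaluating it on the `g`-reciprocal basis. -/
def contract (g : LorentzMetric V) {p : ℕ} (A B : V [⋀^Fin p]→ₗ[ℝ] ℝ) : ℝ :=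
  ∑ c : Fin p → Fin (finrank ℝ V),
    A (fun i => finBasis ℝ V (c i)) *
      B (fun i => BilinForm.dualBasis g.form g.nondegenerate (finBasis ℝ V) (c i))

/-- The superenergy tensor of a `p`-form `Ω`, where `p = q + 1 ≥ 1`:
`T_ab{Ω} = ((-1)^(p-1) / (p-1)!) [Ω_{a a₂…a_p} Ω_b{}^{a₂…a_p} - (1/(2p)) (Ω · Ω) g_ab]`. -/
def superenergy (g : LorentzMetric V) {q : ℕ} (Ω : V [⋀^Fin (q + 1)]→ₗ[ℝ] ℝ) : BilinForm ℝ V :=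
  LinearMap.mk₂ ℝ
    (fun x y => ((-1 : ℝ) ^ q / (q.factorial : ℝ)) *
      (g.contract (Ω.curryLeft x) (Ω.curryLeft y)
        - 1 / (2 * ((q : ℝ) + 1)) * g.contract Ω Ω * g.form x y))
    (fun x x' y => by
      simp only [contract, map_add, AlternatingMap.add_apply, LinearMap.add_apply, add_mul,
        Finset.sum_add_distrib]
      ring)
    (fun a x y => by
      simp only [contract, map_smul, AlternatingMap.smul_apply, LinearMap.smul_apply, smul_eq_mul,
        mul_assoc, ← Finset.mul_sum]
      ring)
    (fun x y y' => by
      simp only [contract, map_add, AlternatingMap.add_apply, mul_add,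
        Finset.sum_add_distrib]
      ring)
    (fun a x y => by
      simp only [contract, map_smul, AlternatingMap.smul_apply, smul_eq_mul,
        mul_left_comm _ a, ← Finset.mul_sum]
      ring)

end LorentzMetric

/-- The exterior product `ω¹ ∧ … ∧ ω^p` of 1-forms: `(v₁, …, v_p) ↦ det (ω^i (v_j))`. -/
def wedge {V : Type*} [AddCommGroup V] [Module ℝ V] {p : ℕ} (ω : Fin p → Dual ℝ V) :
    V [⋀^Fin p]→ₗ[ℝ] ℝ :=
  (Matrix.detRowAlternating : (Fin p → ℝ) [⋀^Fin p]→ₗ[ℝ] ℝ).compLinearMap (LinearMap.pi ω)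

/-- A `p`-form is simple if it is the exterior product of `p` linearly independent 1-forms. -/
def IsSimpleForm {V : Type*} [AddCommGroup V] [Module ℝ V] {p : ℕ}
    (Ω : V [⋀^Fin p]→ₗ[ℝ] ℝ) : Prop :=
  ∃ ω : Fin p → Dual ℝ V, LinearIndependent ℝ ω ∧ Ω = wedge ω

namespace LorentzMetric

variable {V : Type*} [AddCommGroup V] [Module ℝ V] [FiniteDimensional ℝ V]

/-- A form is null if it is simple and `Ω · Ω = 0`. -/
def IsNullForm (g : LorentzMetric V) {p : ℕ} (Ω : V [⋀^Fin p]→ₗ[ℝ] ℝ) : Prop :=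
  IsSimpleForm Ω ∧ g.contract Ω Ω = 0

/-- The set of superenergy tensors of simple `p`-forms, `p ≥ 1`. -/
def SS (g : LorentzMetric V) : Set (BilinForm ℝ V) :=
  {T | ∃ (q : ℕ) (Ω : V [⋀^Fin (q + 1)]→ₗ[ℝ] ℝ), IsSimpleForm Ω ∧ T = g.superenergy Ω}

/-- The set of superenergy tensors of null `p`-forms, `p ≥ 1`. -/
def NS (g : LorentzMetric V) : Set (BilinForm ℝ V) :=
  {T | ∃ (q : ℕ) (Ω : V [⋀^Fin (q + 1)]→ₗ[ℝ] ℝ), g.IsNullForm Ω ∧ T = g.superenergy Ω}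

/-- `A` maps null vectors to null vectors; the image may be the zero vector, which a singular map
cannot avoid. -/
def IsNullConePreserving (g : LorentzMetric V) (A : V →ₗ[ℝ] V) : Prop :=
  ∀ k, g.form k k = 0 → g.form (A k) (A k) = 0

/-- Moreover the transposed map `k_b ↦ A_a{}^b k_b` sends null 1-forms to null 1-forms. -/
def IsNullConeBiPreserving (g : LorentzMetric V) (A : V →ₗ[ℝ] V) : Prop :=
  g.IsNullConePreserving A ∧
    ∀ κ : Dual ℝ V, g.form (g.sharp κ) (g.sharp κ) = 0 →
      g.form (g.sharp (κ ∘ₗ A)) (g.sharp (κ ∘ₗ A)) = 0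

/-- `A` preserves the null cone and its time orientation. The time orientation is the one in which
the timelike vector `t` is future-pointing: a non-zero causal vector `v` is future-pointing iff
`g t v > 0`, and past-pointing iff `g t v < 0`. -/
def IsOrthochronous (g : LorentzMetric V) (t : V) (A : V →ₗ[ℝ] V) : Prop :=
  g.IsNullConePreserving A ∧
    ∀ k, g.form k k = 0 → 0 < g.form t k → A k = 0 ∨ 0 < g.form t (A k)

/-- `A` preserves the null cone and reverses its time orientation. -/
def IsTimeReversal (g : LorentzMetric V) (t : V) (A : V →ₗ[ℝ] V) : Prop :=
  g.IsNullConePreserving A ∧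
    ∀ k, g.form k k = 0 → 0 < g.form t k → A k = 0 ∨ g.form t (A k) < 0

/-- Lorentz transformations: linear isometries of the metric. -/
def IsLorentzTransformation (g : LorentzMetric V) (L : V →ₗ[ℝ] V) : Prop :=
  ∀ x y, g.form (L x) (L y) = g.form x y

end LorentzMetric

/-- `L` is its own inverse. -/
def IsInvolutory {V : Type*} [AddCommGroup V] [Module ℝ V] (L : V →ₗ[ℝ] V) : Prop :=
  L ∘ₗ L = LinearMap.id

end

/-! For a simple form with factors `w`, Gram matrix `G` and `u x = (g(w i, x))_i`, the superenergy
tensor is `T(x, y) = (-1)^q (u x · adj(G) u y - (det G / 2) g(x, y))` (`superenergy_wedge`). As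
`adj(G) G = det G`, the factors are eigenvectors with eigenvalue `μ = (-1)^q det G / 2`, whence `T ×
T = μ² g`, also for degenerate `G`; null forms are exactly the case `μ = 0`. By the matrix
determinant lemma, `T(t, t)` is a positive multiple of the determinant of a positive definite
matrix, so `T(t, t) > 0` (`superenergy_wedge_pos`).

Conversely, let `T ≠ 0` be symmetric with `T × T = f g` and `f ≥ 0`, which is automatic for `N ≥ 3`.
Then `T(t, t) ≠ 0`, and passing to `-T` makes it positive. If `f = 0`, then `T = k ⊗ k` with `k`
null. If `f > 0`, then `T / √f` is an involutory isometry, and `T` is a positive multiple of the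
superenergy tensor of the volume form of its `1`-eigenspace.

The sign of `T(t, t)` decides the time orientation. A singular symmetric null-cone preserving `T`
has `T × T` zero on the null cone, hence `T × T = f g`, and singularity forces `f = 0`. -/

/-- The **matrix determinant lemma**, without an invertibility hypothesis. -/
theorem Matrix.det_add_vecMulVec_real {n : Type*} [Fintype n] [DecidableEq n] (A : Matrix n n ℝ)
    (u v : n → ℝ) : (A + Matrix.vecMulVec u v).det = A.det + v ⬝ᵥ A.adjugate.mulVec u := by
  have hinv : ∀ B : Matrix n n ℝ, B.det ≠ 0 →
      (B + Matrix.vecMulVec u v).det = B.det + v ⬝ᵥ B.adjugate.mulVec u := by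
    intro B hB
    have h := Matrix.det_add_replicateCol_mul_replicateRow (ι := Unit) (isUnit_iff_ne_zero.2 hB) u v
    rw [← Matrix.vecMulVec_eq] at h
    rw [h, Matrix.det_unique (n := Unit), Matrix.inv_def, Ring.inverse_eq_inv']
    simp only [Matrix.add_apply, Matrix.one_apply_eq, Matrix.mul_smul, Matrix.smul_mul,
      Matrix.smul_apply, smul_eq_mul, mul_add, mul_one]
    rw [← mul_assoc, mul_inv_cancel₀ hB, one_mul, Matrix.mul_assoc, Matrix.mul_apply]
    rfl
  -- Only finitely many `A + ε • 1` are singular, so the identity extends to `ε = 0` by continuity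
  -- and density.
  have hfin : {ε : ℝ | (A + ε • (1 : Matrix n n ℝ)).det = 0}.Finite := by
    refine ((-A).charpoly.roots.toFinset.finite_toSet).subset fun ε hε => ?_
    have h0 : (-A).charpoly ≠ 0 := (Matrix.charpoly_monic _).ne_zero
    simp only [Finset.mem_coe, Multiset.mem_toFinset, Polynomial.mem_roots h0, Polynomial.IsRoot,
      Matrix.eval_charpoly]
    rw [sub_neg_eq_add, add_comm, ← hε.out, Matrix.smul_one_eq_diagonal]
    rfl
  have hcont : ∀ f : ℝ → Matrix n n ℝ, Continuous f → Continuous fun ε => (f ε).det :=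
    fun f hf => hf.matrix_det
  have h := Continuous.ext_on (hfin.countable.dense_compl ℝ)
    (f := fun ε : ℝ => (A + ε • (1 : Matrix n n ℝ) + Matrix.vecMulVec u v).det)
    (g := fun ε : ℝ => (A + ε • (1 : Matrix n n ℝ)).det
      + v ⬝ᵥ (A + ε • (1 : Matrix n n ℝ)).adjugate.mulVec u)
    (by fun_prop)
    (by
      have h1 : Continuous fun ε : ℝ => A + ε • (1 : Matrix n n ℝ) := by fun_prop
      exact h1.matrix_det.add
        (continuous_const.dotProduct (h1.matrix_adjugate.matrix_mulVec continuous_const)))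
    (fun ε hε => hinv _ hε)
  simpa using congrFun h 0

/-! ### Superenergy of a simple form through its Gram matrix -/

namespace LorentzMetric

variable {V : Type*} [AddCommGroup V] [Module ℝ V]

theorem form_comm (g : LorentzMetric V) (x y : V) : g.form x y = g.form y x := by
  obtain ⟨n, e, he⟩ := g.exists_orthonormal
  have h : g.form = LinearMap.flip g.form := by
    refine e.ext fun i => e.ext fun j => ?_
    rw [LinearMap.flip_apply, he, he]
    by_cases h : i = j
    · subst h; rfl
    · rw [if_neg h, if_neg (Ne.symm h)]
  exact congrArg (fun B : BilinForm ℝ V => B x y) h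

/-- The Gram matrix of a family of vectors. -/
noncomputable def gram (g : LorentzMetric V) {p : ℕ} (w : Fin p → V) : Matrix (Fin p) (Fin p) ℝ :=
  Matrix.of fun i j => g.form (w i) (w j)

theorem gram_apply (g : LorentzMetric V) {p : ℕ} (w : Fin p → V) (i j : Fin p) :
    g.gram w i j = g.form (w i) (w j) := rfl

theorem wedge_form_apply (g : LorentzMetric V) {p : ℕ} (w v : Fin p → V) :
    wedge (fun i => g.form (w i)) v = (Matrix.of fun i j => g.form (w i) (v j)).det := by
  rw [← Matrix.det_transpose]
  rfl

theorem ext_form (g : LorentzMetric V) {x y : V} (h : ∀ z, g.form x z = g.form y z) : x = y := by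
  rw [← sub_eq_zero]
  refine g.nondegenerate.1 _ fun z => ?_
  rw [map_sub, LinearMap.sub_apply, h, sub_self]

/-- Laplace expansion along the first column; contracting two such expansions yields the minors of
the Gram matrix, i.e. its adjugate. -/
theorem curryLeft_wedge_apply (g : LorentzMetric V) {q : ℕ} (w : Fin (q + 1) → V) (x : V)
    (v : Fin q → V) :
    (wedge fun i => g.form (w i)).curryLeft x v =
      ∑ i : Fin (q + 1), (-1) ^ (i : ℕ) * g.form (w i) x *
        wedge (fun j => g.form (w (i.succAbove j))) v := by
  rw [AlternatingMap.curryLeft_apply_apply, wedge_form_apply, Matrix.det_succ_column_zero]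
  refine Finset.sum_congr rfl fun i _ => ?_
  rw [wedge_form_apply]
  rfl

variable [FiniteDimensional ℝ V]

theorem form_sharp (g : LorentzMetric V) (α : Dual ℝ V) (y : V) : g.form (g.sharp α) y = α y :=
  BilinForm.apply_toDual_symm_apply ..

theorem form_toMap (g : LorentzMetric V) (T : BilinForm ℝ V) (x y : V) :
    g.form (g.toMap T x) y = T x y := g.form_sharp (T x) y

/-- Contracting with a simple form is evaluating on the vectors dual to its factors. -/
theorem contract_wedge (g : LorentzMetric V) {p : ℕ} (w : Fin p → V) (B : V [⋀^Fin p]→ₗ[ℝ] ℝ) :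
    g.contract (wedge fun i => g.form (w i)) B = p.factorial * B w := by
  set b := finBasis ℝ V
  set d := BilinForm.dualBasis g.form g.nondegenerate b with hd
  have hw : ∀ x, ∑ c, g.form x (b c) • d c = x := fun x => by
    conv_rhs => rw [← d.sum_repr x]
    simp only [hd, BilinForm.dualBasis_repr_apply]
  -- Every permutation contributes the same amount: the sign in the determinant cancels the one from
  -- permuting the arguments of `B`.
  have hσ : ∀ σ : Equiv.Perm (Fin p),
      ∑ c : Fin p → Fin (finrank ℝ V), ((Equiv.Perm.sign σ : ℤ) : ℝ) *
        (∏ i, g.form (w (σ i)) (b (c i))) * B (fun i => d (c i)) = B w := by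
    intro σ
    have h1 : B (fun i => w (σ i)) = ∑ c : Fin p → Fin (finrank ℝ V),
        (∏ i, g.form (w (σ i)) (b (c i))) * B (fun i => d (c i)) := by
      conv_lhs => rw [show (fun i => w (σ i)) = fun i => ∑ c, g.form (w (σ i)) (b c) • d c from
        funext fun i => (hw _).symm]
      rw [← AlternatingMap.coe_multilinearMap, MultilinearMap.map_sum]
      refine Finset.sum_congr rfl fun c _ => ?_
      rw [MultilinearMap.map_smul_univ, smul_eq_mul]
    have h2 := B.map_perm w σ
    simp only [mul_assoc]
    rw [← Finset.mul_sum, ← h1]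
    change _ * B (w ∘ σ) = _
    rw [h2, Units.smul_def, zsmul_eq_mul, ← mul_assoc, ← Int.cast_mul, ← Units.val_mul,
      Int.units_mul_self]
    simp
  simp only [contract, wedge_form_apply, Matrix.det_apply', Matrix.of_apply, Finset.sum_mul]
  rw [Finset.sum_comm, Finset.sum_congr rfl fun σ _ => hσ σ, Finset.sum_const, Finset.card_univ,
    Fintype.card_perm, Fintype.card_fin, nsmul_eq_mul]

/-- The superenergy tensor of a simple form in terms of the Gram matrix of its factors. -/
theorem superenergy_wedge (g : LorentzMetric V) {q : ℕ} (w : Fin (q + 1) → V) (x y : V) :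
    g.superenergy (wedge fun i => g.form (w i)) x y =
      (-1) ^ q * ((fun i => g.form (w i) x) ⬝ᵥ
        (g.gram w).adjugate.mulVec (fun i => g.form (w i) y)
          - (g.gram w).det / 2 * g.form x y) := by
  have h1 : g.contract ((wedge fun i => g.form (w i)).curryLeft x)
      ((wedge fun i => g.form (w i)).curryLeft y) = q.factorial * ((fun i => g.form (w i) x) ⬝ᵥ
        (g.gram w).adjugate.mulVec (fun i => g.form (w i) y)) := by
    have h2 : g.contract ((wedge fun i => g.form (w i)).curryLeft x)
        ((wedge fun i => g.form (w i)).curryLeft y) =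
        ∑ i : Fin (q + 1), (-1) ^ (i : ℕ) * g.form (w i) x *
          g.contract (wedge fun j => g.form (w (i.succAbove j)))
            ((wedge fun i => g.form (w i)).curryLeft y) := by
      simp only [contract, curryLeft_wedge_apply g w x, Finset.sum_mul]
      simp only [Finset.mul_sum, mul_assoc]
      exact Finset.sum_comm
    rw [h2, dotProduct, Finset.mul_sum]
    refine Finset.sum_congr rfl fun i _ => ?_
    rw [contract_wedge, curryLeft_wedge_apply, Matrix.mulVec, dotProduct]
    simp only [wedge_form_apply, Finset.mul_sum]
    refine Finset.sum_congr rfl fun j _ => ?_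
    rw [Matrix.adjugate_fin_succ_eq_det_submatrix, pow_add]
    simp only [Matrix.submatrix, gram_apply]
    ring
  have h3 : g.contract (wedge fun i => g.form (w i)) (wedge fun i => g.form (w i)) =
      (q + 1).factorial * (g.gram w).det := by
    rw [contract_wedge, wedge_form_apply]; rfl
  rw [superenergy, LinearMap.mk₂_apply, h1, h3, Nat.factorial_succ]
  have hq : (q.factorial : ℝ) ≠ 0 := by exact_mod_cast q.factorial_ne_zero
  have hq' : (q : ℝ) + 1 ≠ 0 := by positivity
  push_cast
  field_simp

theorem isSimpleForm_iff (g : LorentzMetric V) {p : ℕ} (Ω : V [⋀^Fin p]→ₗ[ℝ] ℝ) :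
    IsSimpleForm Ω ↔ ∃ w : Fin p → V, LinearIndependent ℝ w ∧ Ω = wedge fun i => g.form (w i) := by
  constructor
  · rintro ⟨ω, hω, rfl⟩
    refine ⟨fun i => g.sharp (ω i), hω.map' g.sharp.toLinearMap g.sharp.ker, ?_⟩
    congr 1
    funext i
    exact LinearMap.ext fun y => (g.form_sharp _ y).symm
  · rintro ⟨w, hw, rfl⟩
    exact ⟨_, hw.map' g.form (LinearMap.ker_eq_bot.2 fun x y h =>
      g.ext_form fun z => by rw [h]), rfl⟩

end LorentzMetric

namespace LorentzMetric

section Symmetric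

variable {V : Type*} [AddCommGroup V] [Module ℝ V]

theorem isSymm_neg {T : BilinForm ℝ V} (hT : T.IsSymm) : (-T).IsSymm :=
  ⟨fun x y => congrArg Neg.neg (hT.eq x y)⟩

theorem isSymm_neg_iff {T : BilinForm ℝ V} : (-T).IsSymm ↔ T.IsSymm :=
  ⟨fun h => neg_neg T ▸ isSymm_neg h, isSymm_neg⟩

theorem isSymm_smul {T : BilinForm ℝ V} (hT : T.IsSymm) (c : ℝ) : (c • T).IsSymm :=
  ⟨fun x y => congrArg (c * ·) (hT.eq x y)⟩

end Symmetric

/-! ### Causal geometry of a Lorentzian form -/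

section Causality

variable {V : Type*} [AddCommGroup V] [Module ℝ V] (g : LorentzMetric V) {t x y : V}

/-- The orthogonal complement of a timelike vector is negative definite. -/
theorem form_self_neg (ht : 0 < g.form t t) (hx : g.form t x = 0) (h0 : x ≠ 0) :
    g.form x x < 0 := by
  obtain ⟨n, e, he⟩ := g.exists_orthonormal
  have hf : ∀ x y, g.form x y =
      e.repr x 0 * e.repr y 0 - ∑ i : Fin n, e.repr x i.succ * e.repr y i.succ := by
    intro x y
    conv_lhs => rw [← e.sum_repr x, ← e.sum_repr y]
    simp only [map_sum, map_smul, LinearMap.sum_apply, LinearMap.smul_apply, smul_eq_mul, he,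
      mul_ite, mul_zero, Finset.sum_ite_eq', Finset.mem_univ, if_true]
    rw [Fin.sum_univ_succ]
    simp only [Fin.succ_ne_zero, if_true, if_false, sub_eq_add_neg, ← Finset.sum_neg_distrib]
    congr 1
    · ring
    · exact Finset.sum_congr rfl fun i _ => by ring
  rw [hf] at ht hx ⊢
  -- Reversed Cauchy–Schwarz: with `a b = ∑ tᵢ xᵢ`, this gives `a² b² ≤ P Q`, while `P < a²` and `Q
  -- ≤ b²` force `b = 0`.
  have hcs := Finset.sum_mul_sq_le_sq_mul_sq Finset.univ (fun i : Fin n => e.repr t i.succ)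
    (fun i => e.repr x i.succ)
  simp only [← pow_two] at ht ⊢
  set a := e.repr t 0
  set b := e.repr x 0
  set P := ∑ i : Fin n, e.repr t i.succ ^ 2
  set Q := ∑ i : Fin n, e.repr x i.succ ^ 2 with hQ
  rw [sub_eq_zero] at hx
  rw [← hx] at hcs
  have hP0 : 0 ≤ P := Finset.sum_nonneg fun i _ => sq_nonneg _
  have hQ0 : 0 ≤ Q := Finset.sum_nonneg fun i _ => sq_nonneg _
  by_contra! hneg
  have hb : b = 0 := by
    by_contra hb
    have hb2 : 0 < b ^ 2 := by positivity
    nlinarith [mul_le_mul_of_nonneg_left (sub_nonneg.1 hneg) hP0, mul_pos ht hb2]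
  have hQz : Q = 0 := le_antisymm (by rw [hb] at hneg; linarith) hQ0
  refine h0 (e.ext_elem_iff.2 fun i => ?_)
  rw [map_zero, Finsupp.zero_apply]
  refine Fin.cases hb (fun i => ?_) i
  have := (Finset.sum_eq_zero_iff_of_nonneg fun i _ => sq_nonneg _).1 hQz i (Finset.mem_univ i)
  exact pow_eq_zero_iff two_ne_zero |>.1 this

theorem form_self_nonpos (ht : 0 < g.form t t) (hx : g.form t x = 0) : g.form x x ≤ 0 := by
  rcases eq_or_ne x 0 with rfl | h0
  · simp
  · exact (g.form_self_neg ht hx h0).le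

theorem eq_zero_of_orthogonal (ht : 0 < g.form t t) (hx : g.form t x = 0)
    (h : 0 ≤ g.form x x) : x = 0 := by
  by_contra h0
  exact (g.form_self_neg ht hx h0).not_ge h

theorem timelike_ne_zero (ht : 0 < g.form t t) : t ≠ 0 := by
  rintro rfl; simp at ht

/-- Reflecting the sign of the metric off a timelike direction gives a positive definite form. -/
theorem two_mul_sq_div_sub_pos (ht : 0 < g.form t t) (h0 : x ≠ 0) :
    0 < 2 * g.form t x ^ 2 / g.form t t - g.form x x := by
  have hy : g.form t (x - (g.form t x / g.form t t) • t) = 0 := by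
    rw [map_sub, map_smul, smul_eq_mul]
    field_simp
    ring
  have hyy : g.form (x - (g.form t x / g.form t t) • t) (x - (g.form t x / g.form t t) • t) =
      g.form x x - g.form t x ^ 2 / g.form t t := by
    simp only [map_sub, map_smul, LinearMap.sub_apply, LinearMap.smul_apply, smul_eq_mul,
      g.form_comm x t]
    field_simp
    ring
  have hle := g.form_self_nonpos ht hy
  have hsq : 0 ≤ g.form t x ^ 2 / g.form t t := by positivity
  rw [hyy] at hle
  rw [show 2 * g.form t x ^ 2 / g.form t t = g.form t x ^ 2 / g.form t t
    + g.form t x ^ 2 / g.form t t by ring]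
  by_contra! hneg
  have h1 : g.form t x ^ 2 / g.form t t = 0 := by linarith
  have h2 : g.form t x = 0 := by
    rcases div_eq_zero_iff.1 h1 with h | h
    · exact pow_eq_zero_iff two_ne_zero |>.1 h
    · exact absurd h ht.ne'
  exact h0 (g.eq_zero_of_orthogonal ht h2 (by linarith))

/-- Two future-pointing causal vectors have a non-negative product. -/
theorem form_nonneg_of_causal (ht : 0 < g.form t t) (hx : 0 ≤ g.form x x) (hy : 0 ≤ g.form y y)
    (htx : 0 < g.form t x) (hty : 0 < g.form t y) : 0 ≤ g.form x y := by
  -- This combination is orthogonal to `t`, so its square is non-positive; a negative `g(x, y)`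
  -- would make it positive.
  have h1 : g.form t (g.form t y • x - g.form t x • y) = 0 := by
    simp only [map_sub, map_smul, smul_eq_mul]; ring
  have h2 := g.form_self_nonpos ht h1
  simp only [map_sub, map_smul, LinearMap.sub_apply, LinearMap.smul_apply, smul_eq_mul,
    g.form_comm y x] at h2
  have h3 := mul_pos htx hty
  have h4 := mul_nonneg (sq_nonneg (g.form t y)) hx
  have h5 := mul_nonneg (sq_nonneg (g.form t x)) hy
  by_contra! hneg
  nlinarith [mul_neg_of_pos_of_neg h3 hneg]

theorem exists_orthogonal [FiniteDimensional ℝ V] (hN : 2 ≤ finrank ℝ V) (t : V) :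
    ∃ x, x ≠ 0 ∧ g.form t x = 0 := by
  have h := LinearMap.ker_ne_bot_of_finrank_lt (f := g.form t) (by rw [Module.finrank_self]; omega)
  obtain ⟨x, hx, h0⟩ := (Submodule.ne_bot_iff _).1 h
  exact ⟨x, h0, hx⟩

theorem exists_orthogonal_pair [FiniteDimensional ℝ V] (hN : 3 ≤ finrank ℝ V) (t y : V) :
    ∃ x, x ≠ 0 ∧ g.form t x = 0 ∧ g.form y x = 0 := by
  have h := LinearMap.ker_ne_bot_of_finrank_lt (f := (g.form t).prod (g.form y))
    (by rw [Module.finrank_prod, Module.finrank_self]; omega)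
  obtain ⟨x, hx, h0⟩ := (Submodule.ne_bot_iff _).1 h
  exact ⟨x, h0, Prod.ext_iff.1 hx⟩

/-- With this normalization both `t + r • x` and `t - r • x` are null. -/
theorem exists_orthogonal_normalized (ht : 0 < g.form t t) (hx : g.form t x = 0) (h0 : x ≠ 0) :
    ∃ r : ℝ, r ≠ 0 ∧ g.form (r • x) (r • x) = -g.form t t := by
  have h := g.form_self_neg ht hx h0
  have hpos : 0 < g.form t t / -g.form x x := div_pos ht (by linarith)
  refine ⟨√(g.form t t / -g.form x x), (Real.sqrt_pos.2 hpos).ne', ?_⟩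
  simp only [map_smul, LinearMap.smul_apply, smul_eq_mul]
  rw [← mul_assoc, Real.mul_self_sqrt hpos.le]
  field_simp [h.ne]

/-- A symmetric form vanishing on the null cone is proportional to the metric. -/
theorem eq_smul_form_of_null (ht : 0 < g.form t t) (Q : BilinForm ℝ V) (hQ : Q.IsSymm)
    (h : ∀ k, g.form k k = 0 → Q k k = 0) : Q = (Q t t / g.form t t) • g.form := by
  have hc : ∀ x y, Q x y = Q y x := hQ.eq
  -- Add and subtract the conditions at the null vectors `t ± x`.
  have hunit : ∀ x, g.form t x = 0 → g.form x x = -g.form t t → Q t x = 0 ∧ Q x x = -Q t t := by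
    intro x hx hxx
    have h1 := h (t + x) (by
      simp only [map_add, LinearMap.add_apply, g.form_comm x t]; linarith)
    have h2 := h (t - x) (by
      simp only [map_sub, LinearMap.sub_apply, g.form_comm x t]; linarith)
    simp only [map_add, LinearMap.add_apply, map_sub, LinearMap.sub_apply, hc x t] at h1 h2
    constructor <;> linarith
  have hort : ∀ x, g.form t x = 0 → Q t x = 0 ∧ Q x x = Q t t / g.form t t * g.form x x := by
    intro x hx
    rcases eq_or_ne x 0 with rfl | h0
    · simp
    obtain ⟨r, hr, hrx⟩ := g.exists_orthogonal_normalized ht hx h0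
    obtain ⟨h1, h2⟩ := hunit (r • x) (by rw [map_smul, hx, smul_zero]) hrx
    simp only [map_smul, LinearMap.smul_apply, smul_eq_mul] at h1 h2 hrx
    refine ⟨(mul_eq_zero.1 h1).resolve_left hr, ?_⟩
    have hr2 : r * r ≠ 0 := mul_ne_zero hr hr
    rw [div_mul_eq_mul_div, eq_div_iff ht.ne']
    apply mul_left_cancel₀ hr2
    linear_combination g.form t t * h2 - Q t t * hrx
  have hdiag : ∀ x, Q x x = Q t t / g.form t t * g.form x x := by
    intro x
    obtain ⟨α, v, hv, rfl⟩ : ∃ (α : ℝ) (v : V), g.form t v = 0 ∧ x = α • t + v := by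
      refine ⟨g.form t x / g.form t t, x - (g.form t x / g.form t t) • t, ?_, by abel⟩
      rw [map_sub, map_smul, smul_eq_mul]
      field_simp
      ring
    obtain ⟨h1, h2⟩ := hort v hv
    simp only [map_add, LinearMap.add_apply, map_smul, LinearMap.smul_apply, smul_eq_mul,
      g.form_comm v t, hv, hc v t, h1, h2]
    field_simp
    ring
  refine LinearMap.ext fun x => LinearMap.ext fun y => ?_
  have h1 := hdiag (x + y)
  have h2 := hdiag x
  have h3 := hdiag y
  simp only [map_add, LinearMap.add_apply, hc y x, g.form_comm y x] at h1
  simp only [LinearMap.smul_apply, smul_eq_mul]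
  linarith

theorem isTimeReversal_iff (t : V) (A : V →ₗ[ℝ] V) :
    g.IsTimeReversal t A ↔ g.IsOrthochronous t (-A) := by
  simp [IsTimeReversal, IsOrthochronous, IsNullConePreserving]

end Causality

/-! ### Symmetric tensors with `T × T = f g` -/

section SelfAdjoint

variable {V : Type*} [AddCommGroup V] [Module ℝ V] [FiniteDimensional ℝ V]
  {g : LorentzMetric V} {t : V} {T : BilinForm ℝ V} {f : ℝ}

theorem form_toMap_right (hT : T.IsSymm) (x y : V) : g.form x (g.toMap T y) = T x y := by
  rw [g.form_comm, form_toMap]; exact hT.eq y x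

theorem cross_self_apply (x y : V) :
    g.cross T T x y = g.form (g.toMap T x) (g.toMap T y) := (g.form_toMap T x _).symm

theorem form_toMap_toMap (hf : g.cross T T = f • g.form) (x y : V) :
    g.form (g.toMap T x) (g.toMap T y) = f * g.form x y := by
  rw [← cross_self_apply, hf]; rfl

theorem toMap_toMap (hT : T.IsSymm) (hf : g.cross T T = f • g.form) (x : V) :
    g.toMap T (g.toMap T x) = f • x := by
  refine g.ext_form fun z => ?_
  rw [form_toMap, ← form_toMap_right hT, form_toMap_toMap hf, map_smul]; rfl

theorem toMap_neg : g.toMap (-T) = -g.toMap T := LinearMap.comp_neg ..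

theorem toMap_smul (c : ℝ) : g.toMap (c • T) = c • g.toMap T := LinearMap.comp_smul ..

theorem cross_neg : g.cross (-T) (-T) = g.cross T T := by
  refine LinearMap.ext fun x => LinearMap.ext fun y => ?_
  simp only [cross_self_apply, toMap_neg, LinearMap.neg_apply, map_neg, neg_neg]

theorem cross_smul (c : ℝ) : g.cross (c • T) (c • T) = c ^ 2 • g.cross T T := by
  refine LinearMap.ext fun x => LinearMap.ext fun y => ?_
  simp only [cross_self_apply, toMap_smul, LinearMap.smul_apply, map_smul, smul_eq_mul]
  ring

/-- A non-zero symmetric `T` with `T × T = f g`, `f ≥ 0`, does not vanish on a timelike vector. -/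
theorem apply_self_ne_zero (ht : 0 < g.form t t) (hT : T.IsSymm) (hf : g.cross T T = f • g.form)
    (hf0 : 0 ≤ f) (hT0 : T ≠ 0) : T t t ≠ 0 := by
  intro h
  -- The image of `t` is orthogonal to `t`, yet its square `f g(t, t)` is non-negative.
  have h1 : g.toMap T t = 0 := by
    refine g.eq_zero_of_orthogonal ht ((form_toMap_right hT t t).trans h) ?_
    rw [form_toMap_toMap hf]; positivity
  have h2 : f = 0 := by
    have := form_toMap_toMap hf t t
    rw [h1, map_zero] at this
    exact (mul_eq_zero.1 this.symm).resolve_right ht.ne'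
  refine hT0 (LinearMap.ext fun x => ?_)
  have h3 : g.toMap T x = 0 := by
    refine g.eq_zero_of_orthogonal ht ?_ ?_
    · rw [form_toMap_right hT, ← form_toMap g, h1]; simp
    · rw [form_toMap_toMap hf, h2, zero_mul]
  refine LinearMap.ext fun y => ?_
  rw [← form_toMap g, h3]; simp

/-- In dimension at least 3 some `x ≠ 0` is orthogonal to both `t` and `T t`. Then `x` and `T x`
both lie in the negative semidefinite complement of `t`, so `f g(x, x) ≤ 0` with `g(x, x) < 0`. -/
theorem nonneg_of_cross_eq (hN : 3 ≤ finrank ℝ V) (ht : 0 < g.form t t) (hT : T.IsSymm)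
    (hf : g.cross T T = f • g.form) : 0 ≤ f := by
  by_contra! hneg
  obtain ⟨x, h0, htx, hx⟩ := g.exists_orthogonal_pair hN t (g.toMap T t)
  have h1 := g.form_self_neg ht htx h0
  have h2 : g.form (g.toMap T x) (g.toMap T x) ≤ 0 := by
    refine g.form_self_nonpos ht ?_
    rw [form_toMap_right hT, ← form_toMap g]; exact hx
  rw [form_toMap_toMap hf] at h2
  nlinarith [mul_pos_of_neg_of_neg hneg h1]

theorem isNullConePreserving_toMap (hf : g.cross T T = f • g.form) :
    g.IsNullConePreserving (g.toMap T) := fun k hk => by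
  rw [form_toMap_toMap hf, hk, mul_zero]

/-- `T t` is causal and future-pointing, so `g(t, T k) = g(T t, k) ≥ 0`; in case of equality, `T k`
is null and orthogonal to `t`, hence zero. -/
theorem isOrthochronous_toMap (ht : 0 < g.form t t) (hT : T.IsSymm)
    (hf : g.cross T T = f • g.form) (hf0 : 0 ≤ f) (hpos : 0 < T t t) :
    g.IsOrthochronous t (g.toMap T) := by
  refine ⟨isNullConePreserving_toMap hf, fun k hk htk => ?_⟩
  have h1 : 0 ≤ g.form (g.toMap T t) k := by
    refine g.form_nonneg_of_causal ht ?_ hk.ge ?_ htk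
    · rw [form_toMap_toMap hf]; positivity
    · rwa [form_toMap_right hT]
  rw [form_toMap, ← form_toMap_right (g := g) hT] at h1
  rcases h1.eq_or_lt with h2 | h2
  · left
    exact g.eq_zero_of_orthogonal ht h2.symm (by rw [form_toMap_toMap hf, hk, mul_zero])
  · exact Or.inr h2

/-- Otherwise `T` and `-T` are both orthochronous, so `T` kills every future null vector, hence also
`t`, half the sum of two of them. -/
theorem apply_self_pos_of_isOrthochronous (hN : 2 ≤ finrank ℝ V) (ht : 0 < g.form t t)
    (hT : T.IsSymm) (hf : g.cross T T = f • g.form) (hf0 : 0 ≤ f) (hT0 : T ≠ 0)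
    (h : g.IsOrthochronous t (g.toMap T)) : 0 < T t t := by
  by_contra hle
  have hne := apply_self_ne_zero ht hT hf hf0 hT0
  have hneg : 0 < (-T) t t := by
    rw [LinearMap.neg_apply, LinearMap.neg_apply]
    have := lt_of_le_of_ne (not_lt.1 hle) hne
    linarith
  have h' := isOrthochronous_toMap ht (isSymm_neg hT) (cross_neg.trans hf) hf0 hneg
  rw [toMap_neg] at h'
  have hker : ∀ k, g.form k k = 0 → 0 < g.form t k → g.toMap T k = 0 := by
    intro k hk htk
    rcases h.2 k hk htk with h1 | h1
    · exact h1
    rcases h'.2 k hk htk with h2 | h2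
    · exact neg_eq_zero.1 h2
    rw [LinearMap.neg_apply, map_neg] at h2
    linarith
  obtain ⟨x, hx0, hx⟩ := g.exists_orthogonal hN t
  obtain ⟨r, -, hr⟩ := g.exists_orthogonal_normalized ht hx hx0
  have hx' : g.form t (r • x) = 0 := by rw [map_smul, hx, smul_zero]
  have h1 := hker (t + r • x)
    (by rw [map_add, map_add, LinearMap.add_apply, LinearMap.add_apply, g.form_comm (r • x) t,
          hx', hr]; ring) (by rw [map_add, hx', add_zero]; exact ht)
  have h2 := hker (t - r • x)
    (by rw [map_sub, map_sub, LinearMap.sub_apply, LinearMap.sub_apply, g.form_comm (r • x) t,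
          hx', hr]; ring) (by rw [map_sub, hx', sub_zero]; exact ht)
  rw [map_add] at h1
  rw [map_sub] at h2
  have h3 : (2 : ℝ) • g.toMap T t = 0 := by
    rw [two_smul, ← add_zero (g.toMap T t + g.toMap T t)]
    nth_rewrite 1 [eq_neg_of_add_eq_zero_left h1]
    rw [sub_eq_zero.1 h2]; simp
  have h4 : g.toMap T t = 0 := (smul_eq_zero.1 h3).resolve_left two_ne_zero
  apply hne
  rw [← form_toMap g, h4]; simp

end SelfAdjoint

end LorentzMetric

/-! ### Superenergy tensors of simple forms, and recovering the form -/

namespace LorentzMetric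

section Wedge

variable {V : Type*} [AddCommGroup V] [Module ℝ V]

theorem gram_transpose (g : LorentzMetric V) {p : ℕ} (w : Fin p → V) :
    (g.gram w).transpose = g.gram w := by
  ext i j
  exact g.form_comm _ _

theorem wedge_smul {p : ℕ} (a : Fin p → ℝ) (ω : Fin p → Dual ℝ V) :
    wedge (fun i => a i • ω i) = (∏ i, a i) • wedge ω := by
  ext v
  exact Matrix.det_mul_row a (Matrix.of fun j i => ω i (v j))

theorem isSimpleForm_smul {q : ℕ} {Ω : V [⋀^Fin (q + 1)]→ₗ[ℝ] ℝ} (hΩ : IsSimpleForm Ω) {a : ℝ}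
    (ha : a ≠ 0) : IsSimpleForm (a • Ω) := by
  obtain ⟨ω, hω, rfl⟩ := hΩ
  -- The scalar is absorbed into the factor of index `0`.
  refine ⟨_, hω.units_smul (Pi.mulSingle 0 (Units.mk0 a ha)), ?_⟩
  have h := wedge_smul (fun i => ((Pi.mulSingle 0 (Units.mk0 a ha) : Fin (q + 1) → ℝˣ) i : ℝ)) ω
  rw [← Units.coe_prod, Finset.prod_pi_mulSingle', if_pos (Finset.mem_univ _)] at h
  exact h.symm

end Wedge

section SimpleForm

variable {V : Type*} [AddCommGroup V] [Module ℝ V] [FiniteDimensional ℝ V]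
  {g : LorentzMetric V} {t : V} {T : BilinForm ℝ V} {q : ℕ}

theorem superenergy_wedge_isSymm (g : LorentzMetric V) (w : Fin (q + 1) → V) :
    (g.superenergy (wedge fun i => g.form (w i))).IsSymm := by
  refine ⟨fun x y => ?_⟩
  change g.superenergy _ x y = g.superenergy _ y x
  rw [superenergy_wedge, superenergy_wedge, g.form_comm x y, Matrix.dotProduct_mulVec,
    ← Matrix.mulVec_transpose, Matrix.adjugate_transpose, gram_transpose, dotProduct_comm]

/-- The factors of a simple form are eigenvectors of its superenergy tensor. -/
theorem superenergy_wedge_factor (g : LorentzMetric V) (w : Fin (q + 1) → V) (x : V)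
    (k : Fin (q + 1)) : g.superenergy (wedge fun i => g.form (w i)) x (w k) =
      (-1) ^ q * ((g.gram w).det / 2) * g.form (w k) x := by
  have h : (fun i => g.form (w i) (w k)) = (g.gram w).mulVec (Pi.single k 1) := by
    rw [Matrix.mulVec_single_one]; rfl
  rw [superenergy_wedge, h, Matrix.mulVec_mulVec, Matrix.adjugate_mul, Matrix.smul_mulVec,
    Matrix.one_mulVec, dotProduct_smul, dotProduct_single, g.form_comm x, smul_eq_mul]
  ring

/-- The eigenvector property gives `u (T y) = μ u y`; putting `T y` into the Gram formula gives the
result without splitting the space, so `det G = 0` is allowed. -/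
theorem superenergy_wedge_cross (g : LorentzMetric V) (w : Fin (q + 1) → V) :
    g.cross (g.superenergy (wedge fun i => g.form (w i)))
      (g.superenergy (wedge fun i => g.form (w i))) = ((g.gram w).det / 2) ^ 2 • g.form := by
  have hT := g.superenergy_wedge_isSymm w
  refine LinearMap.ext fun x => LinearMap.ext fun y => ?_
  have h1 : ∀ z, (fun i => g.form (w i) (g.toMap (g.superenergy (wedge fun i => g.form (w i))) z)) =
      ((-1) ^ q * ((g.gram w).det / 2)) • fun i => g.form (w i) z := by
    intro z
    funext k
    rw [g.form_comm, form_toMap, superenergy_wedge_factor]; rfl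
  rw [cross_self_apply, form_toMap, superenergy_wedge, h1, Matrix.mulVec_smul, dotProduct_smul,
    form_toMap_right hT, superenergy_wedge, LinearMap.smul_apply, LinearMap.smul_apply]
  simp only [smul_eq_mul]
  have hs : ((-1 : ℝ) ^ q) * (-1) ^ q = 1 := by rw [← mul_pow]; simp
  linear_combination (((g.gram w).det / 2) ^ 2 * g.form x y) * hs

/-- The superenergy tensor of a simple form is positive on timelike vectors. -/
theorem superenergy_wedge_pos (ht : 0 < g.form t t) {w : Fin (q + 1) → V}
    (hw : LinearIndependent ℝ w) : 0 < g.superenergy (wedge fun i => g.form (w i)) t t := by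
  set u : Fin (q + 1) → ℝ := fun i => g.form (w i) t with hu
  -- Gram matrix of the factors for the positive definite form `2 g(t, ·)² / g(t, t) - g`.
  set E : Matrix (Fin (q + 1)) (Fin (q + 1)) ℝ :=
    -(g.gram w + Matrix.vecMulVec ((-2 / g.form t t) • u) u) with hE
  have hEij : ∀ i j, E i j = 2 / g.form t t * (u i * u j) - g.form (w i) (w j) := by
    intro i j
    rw [hE, Matrix.neg_apply, Matrix.add_apply, Matrix.vecMulVec_apply, gram_apply, Pi.smul_apply,
      smul_eq_mul]
    ring
  have hpos : E.PosDef := by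
    refine Matrix.PosDef.of_dotProduct_mulVec_pos ?_ fun x hx => ?_
    · ext i j
      rw [Matrix.conjTranspose_apply, hEij, hEij, g.form_comm (w j), star_trivial, mul_comm (u j)]
    · have hX : ∑ i, x i • w i ≠ 0 := fun h =>
        hx (funext (Fintype.linearIndependent_iff.1 hw x h))
      have h1 := g.two_mul_sq_div_sub_pos ht hX
      have h2 : g.form t (∑ i, x i • w i) = ∑ i, x i * u i := by
        rw [map_sum]
        exact Finset.sum_congr rfl fun i _ => by rw [map_smul, smul_eq_mul, g.form_comm]
      have h3 : g.form (∑ i, x i • w i) (∑ i, x i • w i) =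
          ∑ i, ∑ j, x i * x j * g.form (w i) (w j) := by
        simp only [map_sum, map_smul, smul_eq_mul, LinearMap.sum_apply, LinearMap.smul_apply,
          Finset.mul_sum]
        rw [Finset.sum_comm]
        exact Finset.sum_congr rfl fun i _ => Finset.sum_congr rfl fun j _ => by ring
      rw [h2, h3] at h1
      refine h1.trans_eq (Eq.symm ?_)
      simp only [dotProduct, Matrix.mulVec, hEij, star_trivial, Finset.mul_sum]
      rw [pow_two, Finset.sum_mul_sum, mul_div_right_comm, Finset.mul_sum,
        ← Finset.sum_sub_distrib]
      refine Finset.sum_congr rfl fun i _ => ?_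
      rw [Finset.mul_sum, ← Finset.sum_sub_distrib]
      exact Finset.sum_congr rfl fun j _ => by ring
  have hdet : E.det = (-1) ^ (q + 1) * ((g.gram w).det
      + -2 / g.form t t * (u ⬝ᵥ (g.gram w).adjugate.mulVec u)) := by
    rw [hE, Matrix.det_neg, Fintype.card_fin, Matrix.det_add_vecMulVec_real, Matrix.mulVec_smul,
      dotProduct_smul, smul_eq_mul]
  have h4 : g.superenergy (wedge fun i => g.form (w i)) t t = g.form t t / 2 * E.det := by
    rw [superenergy_wedge, hdet]
    field_simp
    ring
  rw [h4]
  exact mul_pos (half_pos ht) hpos.det_pos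

theorem superenergy_smul (g : LorentzMetric V) (a : ℝ) (Ω : V [⋀^Fin (q + 1)]→ₗ[ℝ] ℝ) :
    g.superenergy (a • Ω) = a ^ 2 • g.superenergy Ω := by
  have h : ∀ {p : ℕ} (A B : V [⋀^Fin p]→ₗ[ℝ] ℝ),
      g.contract (a • A) (a • B) = a ^ 2 * g.contract A B := by
    intro p A B
    simp only [contract, AlternatingMap.smul_apply, smul_eq_mul, Finset.mul_sum]
    exact Finset.sum_congr rfl fun c _ => by ring
  refine LinearMap.ext fun x => LinearMap.ext fun y => ?_
  have h2 : ∀ x, (a • Ω).curryLeft x = a • Ω.curryLeft x := fun x => rfl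
  simp only [superenergy, LinearMap.mk₂_apply, LinearMap.smul_apply, smul_eq_mul, h, h2]
  ring

theorem smul_mem_SS (hT : T ∈ g.SS) {r : ℝ} (hr : 0 < r) : r • T ∈ g.SS := by
  obtain ⟨q, Ω, hΩ, rfl⟩ := hT
  refine ⟨q, √r • Ω, isSimpleForm_smul hΩ (Real.sqrt_pos.2 hr).ne', ?_⟩
  rw [superenergy_smul, Real.sq_sqrt hr.le]

theorem NS_subset_SS : g.NS ⊆ g.SS := fun _ ⟨q, Ω, hΩ, h⟩ => ⟨q, Ω, hΩ.1, h⟩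

theorem contract_wedge_self (g : LorentzMetric V) {p : ℕ} (w : Fin p → V) :
    g.contract (wedge fun i => g.form (w i)) (wedge fun i => g.form (w i)) =
      p.factorial * (g.gram w).det := by
  rw [contract_wedge, wedge_form_apply]; rfl

theorem isNullForm_wedge_iff {p : ℕ} {w : Fin p → V} (hw : LinearIndependent ℝ w) :
    g.IsNullForm (wedge fun i => g.form (w i)) ↔ (g.gram w).det = 0 := by
  rw [IsNullForm, contract_wedge_self, mul_eq_zero,
    or_iff_right (Nat.cast_ne_zero.2 p.factorial_ne_zero)]
  exact and_iff_right ((g.isSimpleForm_iff _).2 ⟨w, hw, rfl⟩)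

theorem properties_of_mem_SS (ht : 0 < g.form t t) (hT : T ∈ g.SS) :
    T.IsSymm ∧ 0 < T t t ∧ ∃ f : ℝ, 0 ≤ f ∧ g.cross T T = f • g.form ∧ (T ∉ g.NS → 0 < f) := by
  obtain ⟨q, Ω, hΩ, rfl⟩ := hT
  obtain ⟨w, hw, rfl⟩ := (g.isSimpleForm_iff Ω).1 hΩ
  refine ⟨g.superenergy_wedge_isSymm w, superenergy_wedge_pos ht hw, _, sq_nonneg _,
    g.superenergy_wedge_cross w, fun h => ?_⟩
  have hd : (g.gram w).det ≠ 0 := fun hd => h ⟨q, _, (isNullForm_wedge_iff hw).2 hd, rfl⟩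
  positivity

theorem cross_eq_zero_of_mem_NS (hT : T ∈ g.NS) : g.cross T T = 0 := by
  obtain ⟨q, Ω, hΩ, rfl⟩ := hT
  obtain ⟨w, hw, rfl⟩ := (g.isSimpleForm_iff Ω).1 hΩ.1
  rw [superenergy_wedge_cross, (isNullForm_wedge_iff hw).1 hΩ]
  simp

/-- A symmetric square-zero tensor that is positive on a timelike vector is the square of a null
1-form. -/
theorem mem_NS_of_cross_eq_zero (ht : 0 < g.form t t) (hT : T.IsSymm) (h : g.cross T T = 0)
    (hpos : 0 < T t t) : T ∈ g.NS := by
  have hf : g.cross T T = (0 : ℝ) • g.form := by rw [h, zero_smul]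
  have hnull : ∀ x y, g.form (g.toMap T x) (g.toMap T y) = 0 := fun x y => by
    rw [form_toMap_toMap hf, zero_mul]
  set k := g.toMap T t with hk
  -- The difference of the two sides is null and orthogonal to `t`, hence zero: the image of `T` is
  -- the line of `k`.
  have hmap : ∀ x, g.toMap T x = (T t x / T t t) • k := by
    intro x
    rw [← sub_eq_zero]
    refine g.eq_zero_of_orthogonal ht ?_ ?_
    · rw [map_sub, map_smul, form_toMap_right hT, hk, form_toMap_right hT, smul_eq_mul]
      field_simp
      ring
    · simp [hnull, hk]
  -- With this scale, `T` is the square of the 1-form dual to `r • k`.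
  set r := (√(T t t))⁻¹ with hr
  have hr0 : r ≠ 0 := (inv_pos.2 (Real.sqrt_pos.2 hpos)).ne'
  have hr2 : r * r = (T t t)⁻¹ := by rw [hr, ← mul_inv, Real.mul_self_sqrt hpos.le]
  have hk0 : k ≠ 0 := by
    intro h0
    rw [← form_toMap g, ← hk, h0] at hpos
    simp at hpos
  let _ : Unique (Fin (0 + 1)) := inferInstanceAs (Unique (Fin 1))
  have hw : LinearIndependent ℝ (fun _ : Fin (0 + 1) => r • k) :=
    LinearIndependent.of_subsingleton (0 : Fin (0 + 1)) (smul_ne_zero hr0 hk0)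
  have hdet : (g.gram fun _ : Fin (0 + 1) => r • k).det = 0 := by
    rw [Matrix.det_unique, gram_apply]
    simp [hnull, hk]
  refine ⟨0, _, (isNullForm_wedge_iff hw).2 hdet, ?_⟩
  refine LinearMap.ext fun x => LinearMap.ext fun y => ?_
  rw [superenergy_wedge, hdet, Matrix.adjugate_subsingleton, Matrix.one_mulVec, ← form_toMap g,
    hmap]
  simp only [dotProduct, Finset.univ_unique, Finset.sum_singleton, map_smul, LinearMap.smul_apply,
    smul_eq_mul, hk, form_toMap]
  rw [div_eq_mul_inv, ← hr2]
  ring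

/-- A positive multiple of an involutory Lorentz transformation preserving the time orientation
is the superenergy tensor of the volume form of its `1`-eigenspace. -/
theorem mem_SS_of_involutory (ht : 0 < g.form t t) {L : V →ₗ[ℝ] V}
    (hL : g.IsLorentzTransformation L) (hLL : ∀ x, L (L x) = x) (hLt : 0 < g.form t (L t)) {c : ℝ}
    (hc : 0 < c) (hT : g.toMap T = c • L) : T ∈ g.SS := by
  have hsa : ∀ x y, g.form x (L y) = g.form (L x) y := fun x y => by
    rw [← hL x, hLL]
  set W : Submodule ℝ V := LinearMap.ker (L - LinearMap.id) with hW
  have hmem : ∀ x, x ∈ W ↔ L x = x := fun x => by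
    rw [hW, LinearMap.mem_ker, LinearMap.sub_apply, LinearMap.id_apply, sub_eq_zero]
  -- This non-zero fixed vector ensures that the volume form of `W` has degree at least 1.
  have hne : t + L t ∈ W := by rw [hmem, map_add, hLL, add_comm]
  have hne0 : t + L t ≠ 0 := by
    intro h0
    have h1 : g.form t (t + L t) = 0 := by rw [h0, map_zero]
    rw [map_add] at h1
    linarith
  have hrank : 0 < finrank ℝ W := Module.finrank_pos_iff_exists_ne_zero.2
    ⟨⟨_, hne⟩, fun h => hne0 (congrArg Subtype.val h)⟩
  obtain ⟨q, hq⟩ := Nat.exists_eq_add_one_of_ne_zero hrank.ne'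
  let b : Basis (Fin (q + 1)) ℝ W := Module.finBasisOfFinrankEq ℝ W hq
  let w : Fin (q + 1) → V := fun i => b i
  have hw : LinearIndependent ℝ w := b.linearIndependent.map' W.subtype W.ker_subtype
  set S := g.superenergy (wedge fun i => g.form (w i)) with hS
  set μ := (-1) ^ q * ((g.gram w).det / 2) with hμ
  have hplus : ∀ x y, y ∈ W → S x y = μ * g.form x y := by
    intro x y hy
    have hy' : y = ∑ i, b.repr ⟨y, hy⟩ i • w i := by
      have := congrArg W.subtype (b.sum_repr ⟨y, hy⟩)
      rw [map_sum] at this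
      exact this.symm
    rw [hy', map_sum, map_sum, Finset.mul_sum]
    refine Finset.sum_congr rfl fun i _ => ?_
    rw [map_smul, map_smul, hS, superenergy_wedge_factor, g.form_comm (w i), smul_eq_mul,
      smul_eq_mul]
    ring
  -- The `-1`-eigenspace is orthogonal to `W`, so only the metric term of the Gram formula survives.
  have hminus : ∀ x y, L y = -y → S x y = -(μ * g.form x y) := by
    intro x y hy
    have h0 : (fun i => g.form (w i) y) = 0 := by
      funext i
      have h1 := hL (w i) y
      rw [(hmem _).1 (b i).2, hy, map_neg] at h1
      change g.form (w i) y = 0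
      linarith
    rw [hS, superenergy_wedge, h0, Matrix.mulVec_zero, dotProduct_zero]
    ring
  have hSL : ∀ x y, S x y = μ * g.form x (L y) := by
    intro x y
    have h1 := hplus x (y + L y) (by rw [hmem, map_add, hLL, add_comm])
    have h2 := hminus x (y - L y) (by rw [map_sub, hLL, neg_sub])
    simp only [map_add, map_sub] at h1 h2
    linarith
  -- Positivity of `S t t` fixes the sign of `μ` and shows that `W` is non-degenerate.
  have hμ0 : 0 < μ := by
    have h1 : 0 < S t t := superenergy_wedge_pos ht hw
    rw [hSL] at h1
    exact pos_of_mul_pos_left h1 hLt.le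
  have hTS : T = (c / μ) • S := by
    refine LinearMap.ext fun x => LinearMap.ext fun y => ?_
    rw [← form_toMap g, hT, LinearMap.smul_apply, LinearMap.smul_apply, LinearMap.smul_apply,
      map_smul, LinearMap.smul_apply, hSL, hsa, smul_eq_mul, smul_eq_mul]
    field_simp
  rw [hTS]
  exact smul_mem_SS ⟨q, _, (g.isSimpleForm_iff _).2 ⟨w, hw, rfl⟩, rfl⟩ (div_pos hc hμ0)

theorem mem_SS_of_cross_eq (ht : 0 < g.form t t) (hT : T.IsSymm) {f : ℝ} (hf0 : 0 ≤ f)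
    (hf : g.cross T T = f • g.form) (hpos : 0 < T t t) : T ∈ g.SS := by
  rcases hf0.eq_or_lt with rfl | hf0
  · exact NS_subset_SS (mem_NS_of_cross_eq_zero ht hT (by rw [hf, zero_smul]) hpos)
  have hs := Real.sqrt_pos.2 hf0
  have hsq : (√f)⁻¹ * (√f)⁻¹ = f⁻¹ := by rw [← mul_inv, Real.mul_self_sqrt hf0.le]
  refine mem_SS_of_involutory ht (L := (√f)⁻¹ • g.toMap T) (c := √f) (fun x y => ?_) (fun x => ?_)
    ?_ hs (by rw [smul_smul, mul_inv_cancel₀ hs.ne', one_smul])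
  · simp only [LinearMap.smul_apply, map_smul, smul_eq_mul]
    rw [form_toMap_toMap hf, ← mul_assoc, hsq, ← mul_assoc, inv_mul_cancel₀ hf0.ne', one_mul]
  · simp only [LinearMap.smul_apply, map_smul]
    rw [toMap_toMap hT hf, smul_smul, smul_smul, hsq, inv_mul_cancel₀ hf0.ne', one_smul]
  · rw [LinearMap.smul_apply, map_smul, form_toMap_right hT]
    exact mul_pos (inv_pos.2 hs) hpos

end SimpleForm

/-! ### The three characterizations -/

section Characterization

variable {V : Type*} [AddCommGroup V] [Module ℝ V] [FiniteDimensional ℝ V]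
  {g : LorentzMetric V} {t : V} {T : BilinForm ℝ V}

theorem exists_cross_eq_iff (hN : 2 ≤ finrank ℝ V) (ht : 0 < g.form t t) (hT : T.IsSymm) :
    (∃ f : ℝ, (finrank ℝ V = 2 → 0 ≤ f) ∧ g.cross T T = f • g.form) ↔
      (T = 0 ∨ T ∈ g.SS ∨ -T ∈ g.SS) := by
  constructor
  · rintro ⟨f, h2, hf⟩
    have hf0 : 0 ≤ f := by
      rcases hN.eq_or_lt with h | h
      · exact h2 h.symm
      · exact nonneg_of_cross_eq h ht hT hf
    rcases eq_or_ne T 0 with h0 | h0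
    · exact Or.inl h0
    rcases (apply_self_ne_zero ht hT hf hf0 h0).lt_or_gt with h | h
    · refine Or.inr (Or.inr (mem_SS_of_cross_eq ht (isSymm_neg hT) hf0 (cross_neg.trans hf) ?_))
      rw [LinearMap.neg_apply, LinearMap.neg_apply]
      exact neg_pos.2 h
    · exact Or.inr (Or.inl (mem_SS_of_cross_eq ht hT hf0 hf h))
  · rintro (rfl | h | h)
    · refine ⟨0, fun _ => le_rfl, ?_⟩
      refine LinearMap.ext fun x => LinearMap.ext fun y => ?_
      rw [zero_smul]
      rfl
    · obtain ⟨-, -, f, hf0, hf, -⟩ := properties_of_mem_SS ht h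
      exact ⟨f, fun _ => hf0, hf⟩
    · obtain ⟨-, -, f, hf0, hf, -⟩ := properties_of_mem_SS ht h
      exact ⟨f, fun _ => hf0, cross_neg.symm.trans hf⟩

theorem mem_SS_diff_NS_iff (hN : 2 ≤ finrank ℝ V) (ht : 0 < g.form t t) :
    T ∈ g.SS \ g.NS ↔ ∃ (c : ℝ) (L : V →ₗ[ℝ] V), 0 < c ∧ g.IsLorentzTransformation L ∧
      IsInvolutory L ∧ g.IsOrthochronous t L ∧ g.toMap T = c • L := by
  constructor
  · rintro ⟨hSS, hNS⟩
    obtain ⟨hT, hpos, f, -, hf, hf0⟩ := properties_of_mem_SS ht hSS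
    have hs := Real.sqrt_pos.2 (hf0 hNS)
    have hT' := isSymm_smul hT (√f)⁻¹
    have hf' : g.cross ((√f)⁻¹ • T) ((√f)⁻¹ • T) = (1 : ℝ) • g.form := by
      rw [cross_smul, hf, smul_smul, inv_pow, Real.sq_sqrt (hf0 hNS).le,
        inv_mul_cancel₀ (hf0 hNS).ne']
    refine ⟨√f, g.toMap ((√f)⁻¹ • T), hs, fun x y => ?_, LinearMap.ext fun x => ?_,
      isOrthochronous_toMap ht hT' hf' zero_le_one (mul_pos (inv_pos.2 hs) hpos), ?_⟩
    · rw [form_toMap_toMap hf', one_mul]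
    · exact (toMap_toMap hT' hf' x).trans (one_smul ℝ x)
    · rw [toMap_smul, smul_smul, mul_inv_cancel₀ hs.ne', one_smul]
  · rintro ⟨c, L, hc, hL, hLL, ho, hTL⟩
    have hLL' : ∀ x, L (L x) = x := fun x => LinearMap.congr_fun hLL x
    have hT' : g.toMap (c⁻¹ • T) = L := by
      rw [toMap_smul, hTL, smul_smul, inv_mul_cancel₀ hc.ne', one_smul]
    -- An isometry that is its own inverse is self-adjoint.
    have hsymm : (c⁻¹ • T).IsSymm := by
      refine ⟨fun x y => ?_⟩
      change (c⁻¹ • T) x y = (c⁻¹ • T) y x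
      rw [← form_toMap g, ← form_toMap g (c⁻¹ • T) y, hT', ← hL, hLL', g.form_comm]
    have hf' : g.cross (c⁻¹ • T) (c⁻¹ • T) = (1 : ℝ) • g.form := by
      refine LinearMap.ext fun x => LinearMap.ext fun y => ?_
      rw [cross_self_apply, hT', hL, one_smul]
    have h0 : c⁻¹ • T ≠ 0 := by
      intro h
      rw [h] at hT'
      have h1 : L t = 0 := by rw [← hT']; exact map_zero g.sharp
      have h2 := hLL' t
      rw [h1, map_zero] at h2
      exact g.timelike_ne_zero ht h2.symm
    have hpos := apply_self_pos_of_isOrthochronous hN ht hsymm hf' zero_le_one h0 (hT'.symm ▸ ho)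
    rw [← form_toMap g, hT', g.form_comm] at hpos
    refine ⟨mem_SS_of_involutory ht hL hLL' hpos hc hTL, fun hNS => ?_⟩
    have h1 := cross_eq_zero_of_mem_NS hNS
    have h2 : g.form (g.toMap T t) (g.toMap T t) = 0 := by rw [← cross_self_apply, h1]; rfl
    simp only [hTL, LinearMap.smul_apply, map_smul, smul_eq_mul] at h2
    rw [hL] at h2
    exact (mul_pos hc (mul_pos hc ht)).ne' h2

/-- For symmetric `T`, raising the index turns the transposed map into `g.toMap T` itself. -/
theorem isNullConeBiPreserving_toMap (hT : T.IsSymm) {f : ℝ} (hf : g.cross T T = f • g.form) :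
    g.IsNullConeBiPreserving (g.toMap T) := by
  refine ⟨isNullConePreserving_toMap hf, fun κ hκ => ?_⟩
  have h : g.sharp (κ ∘ₗ g.toMap T) = g.toMap T (g.sharp κ) := by
    refine g.ext_form fun z => ?_
    rw [form_sharp, form_toMap, ← form_toMap_right hT, form_sharp]; rfl
  rw [h, form_toMap_toMap hf, hκ, mul_zero]

theorem mem_NS_iff (hN : 2 ≤ finrank ℝ V) (ht : 0 < g.form t t) :
    T ∈ g.NS ↔ T ≠ 0 ∧ T.IsSymm ∧ LinearMap.det (g.toMap T) = 0 ∧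
      g.IsNullConeBiPreserving (g.toMap T) ∧ g.IsOrthochronous t (g.toMap T) := by
  have hdet : ∀ f : ℝ, T.IsSymm → g.cross T T = f • g.form →
      LinearMap.det (g.toMap T) * LinearMap.det (g.toMap T) = f ^ finrank ℝ V := by
    intro f hT hf
    rw [← LinearMap.det_comp, show g.toMap T ∘ₗ g.toMap T = f • LinearMap.id from
      LinearMap.ext (toMap_toMap hT hf), LinearMap.det_smul, LinearMap.det_id, mul_one]
  constructor
  · intro h
    obtain ⟨hT, hpos, -⟩ := properties_of_mem_SS ht (NS_subset_SS h)
    have hf : g.cross T T = (0 : ℝ) • g.form := by rw [cross_eq_zero_of_mem_NS h, zero_smul]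
    refine ⟨?_, hT, ?_, isNullConeBiPreserving_toMap hT hf,
      isOrthochronous_toMap ht hT hf le_rfl hpos⟩
    · rintro rfl
      simp at hpos
    · have h1 := hdet 0 hT hf
      rw [zero_pow (by omega)] at h1
      exact mul_self_eq_zero.1 h1
  · rintro ⟨h0, hT, hd, hb, ho⟩
    have hQ : (g.cross T T).IsSymm := ⟨fun x y => by
      change g.cross T T x y = g.cross T T y x
      rw [cross_self_apply, cross_self_apply, g.form_comm]⟩
    -- Null-cone preservation says that the symmetric form `T × T` vanishes on null vectors; then
    -- `det² = f ^ N` and singularity give `f = 0`.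
    have hf := g.eq_smul_form_of_null ht _ hQ fun k hk => by rw [cross_self_apply]; exact hb.1 k hk
    set f := g.cross T T t t / g.form t t
    have hf0 : f = 0 := by
      have h1 := hdet f hT hf
      rw [hd, zero_mul] at h1
      exact pow_eq_zero_iff (by omega) |>.1 h1.symm
    exact mem_NS_of_cross_eq_zero ht hT (by rw [hf, hf0, zero_smul])
      (apply_self_pos_of_isOrthochronous hN ht hT hf hf0.ge h0 ho)

theorem isNullConeBiPreserving_neg (A : V →ₗ[ℝ] V) :
    g.IsNullConeBiPreserving (-A) ↔ g.IsNullConeBiPreserving A := by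
  simp [IsNullConeBiPreserving, IsNullConePreserving, LinearMap.comp_neg]

theorem det_neg_eq_zero_iff (A : V →ₗ[ℝ] V) : LinearMap.det (-A) = 0 ↔ LinearMap.det A = 0 := by
  rw [← neg_one_smul ℝ A, LinearMap.det_smul, mul_eq_zero, or_iff_right]
  exact pow_ne_zero _ (by norm_num)

end Characterization

end LorentzMetric

theorem mainTheorem2 {V : Type*} [AddCommGroup V] [Module ℝ V] [FiniteDimensional ℝ V]
    (hN : 2 ≤ finrank ℝ V) (g : LorentzMetric V) (t : V) (ht : 0 < g.form t t) :
    (∀ T : BilinForm ℝ V, T.IsSymm →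
      ((∃ f : ℝ, (finrank ℝ V = 2 → 0 ≤ f) ∧ g.cross T T = f • g.form) ↔
        (T = 0 ∨ T ∈ g.SS ∨ -T ∈ g.SS))) ∧
    (∀ T : BilinForm ℝ V, T ∈ g.SS \ g.NS ↔
      ∃ (c : ℝ) (L : V →ₗ[ℝ] V), 0 < c ∧ g.IsLorentzTransformation L ∧ IsInvolutory L ∧
        g.IsOrthochronous t L ∧ g.toMap T = c • L) ∧
    (∀ T : BilinForm ℝ V, -T ∈ g.SS \ g.NS ↔
      ∃ (c : ℝ) (L : V →ₗ[ℝ] V), 0 < c ∧ g.IsLorentzTransformation L ∧ IsInvolutory L ∧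
        g.IsTimeReversal t L ∧ g.toMap T = c • L) ∧
    (∀ T : BilinForm ℝ V, T ∈ g.NS ↔
      T ≠ 0 ∧ T.IsSymm ∧ LinearMap.det (g.toMap T) = 0 ∧
        g.IsNullConeBiPreserving (g.toMap T) ∧ g.IsOrthochronous t (g.toMap T)) ∧
    (∀ T : BilinForm ℝ V, -T ∈ g.NS ↔
      T ≠ 0 ∧ T.IsSymm ∧ LinearMap.det (g.toMap T) = 0 ∧
        g.IsNullConeBiPreserving (g.toMap T) ∧ g.IsTimeReversal t (g.toMap T)) := by
  refine ⟨fun T hT => LorentzMetric.exists_cross_eq_iff hN ht hT,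
    fun T => LorentzMetric.mem_SS_diff_NS_iff hN ht, fun T => ?_,
    fun T => LorentzMetric.mem_NS_iff hN ht, fun T => ?_⟩
  -- Replacing `L` by `-L` keeps it an involutory isometry and exchanges orthochronous with
  -- time-reversal.
  · rw [LorentzMetric.mem_SS_diff_NS_iff hN ht, LorentzMetric.toMap_neg]
    constructor
    · rintro ⟨c, L, hc, hL, hLL, ho, hT⟩
      refine ⟨c, -L, hc, fun x y => ?_, ?_, ?_, ?_⟩
      · rw [LinearMap.neg_apply, LinearMap.neg_apply, map_neg, map_neg, LinearMap.neg_apply,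
          neg_neg, hL]
      · rwa [IsInvolutory, LinearMap.neg_comp, LinearMap.comp_neg, neg_neg]
      · rwa [LorentzMetric.isTimeReversal_iff, neg_neg]
      · rw [smul_neg, ← hT, neg_neg]
    · rintro ⟨c, L, hc, hL, hLL, ho, hT⟩
      refine ⟨c, -L, hc, fun x y => ?_, ?_, ?_, ?_⟩
      · rw [LinearMap.neg_apply, LinearMap.neg_apply, map_neg, map_neg, LinearMap.neg_apply,
          neg_neg, hL]
      · rwa [IsInvolutory, LinearMap.neg_comp, LinearMap.comp_neg, neg_neg]
      · rwa [← LorentzMetric.isTimeReversal_iff]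
      · rw [smul_neg, hT]
  · rw [LorentzMetric.mem_NS_iff hN ht, LorentzMetric.toMap_neg,
      LorentzMetric.isSymm_neg_iff, LorentzMetric.det_neg_eq_zero_iff,
      LorentzMetric.isNullConeBiPreserving_neg, ← LorentzMetric.isTimeReversal_iff]
    exact and_congr_left' (not_congr (neg_eq_zero (a := (T : V →ₗ[ℝ] V →ₗ[ℝ] ℝ))))
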